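/- **Setting.** EVM code is a finite list of EVM instructions with symbolic jump destinations: $\mathtt{PUSH}$ (of a 256-bit word or of the address of a label), $\mathtt{POP}$, $\mathtt{DUP1}$–$\mathtt{DUP16}$, $\mathtt{SWAP1}$–$\mathtt{SWAP16}$, the arithmetic, comparison, bitwise and shift operations, the environment reads, storage, memory, hashing, copying, logging, calls and contract creation, $\mathtt{JUMPDEST}$ (a label), $\mathtt{JUMP}$, $\mathtt{JUMPI}$, and the halting instructions; $\mathtt{GAS}$ and $\mathtt{PC}$ are excluded. A *global state* consists of the stack (at most 1024 words), memory and its active size, the contract storage, the balances, the logs, the return data, the state of the other contracts, and the natural number of gas units consumed so far. Each instruction adds its gas cost (Petersburg fee schedule) to this counter. The message and block data, the label addresses, the byte image read by the code-copying instruction, the hash function, and the behaviour of the other accounts (a function of the call data and the state without its gas counter) form an arbitrary machine environment that is fixed during a run. A run of a program halts (with a kind of halting, an output and a final state), diverges, or *faults* (stack underflow or overflow). The *search model* of the optimizer knows only the stack, the storage and the gas, and the instructions acting on them ($\mathtt{PUSH}$, $\mathtt{POP}$, $\mathtt{DUP}$, $\mathtt{SWAP}$, arithmetic, comparisons, bitwise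 operations, environment reads, $\mathtt{SLOAD}$, $\mathtt{SSTORE}$); environment reads are uninterpreted functions. A rewrite rule $p \to p_o$ is a pair of instruction sequences; a schematic rule is the family of its instances. It is *generated* if both sequences consist of instructions of the model, if for every interpretation of the uninterpreted functions and every model state with at most 1024 stack entries from which $p$ runs without exceptional halting, $p_o$ also runs and yields the same stack and storage with strictly less gas consumed, and if the sum of the state-independent instruction costs (the *static gas cost*) of $p_o$ is strictly less than that of $p$. **Theorem.** 1. The following rules are generated, where $x,y,v,w,k$ are arbitrary words, $1\le n\le 16$, and $\varepsilon$ is the empty sequence. *Stack:* $\mathtt{DUP}n\,\mathtt{SWAP}n\to\mathtt{DUP}n$; $\mathtt{PUSH}\,x\,\mathtt{POP}\to\varepsilon$, also for the address of a label instead of $x$; $\mathtt{DUP}n\,\mathtt{POP}\to\varepsilon$; $\mathtt{SWAP}n\,\mathtt{SWAP}n\to\varepsilon$; $\mathtt{SWAP1}\,\mathtt{POP}\,\mathtt{POP}\to\mathtt{POP}\,\mathtt{POP}$; $\mathtt{SWAP1}\,\mathtt{DUP2}\,\mathtt{SWAP1}\to\mathtt{DUP1}\,\mathtt{SWAP2}$;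 $\mathrm{op}\,\mathtt{POP}\to\mathtt{POP}^r$ for every unary, binary or ternary operation or environment read $\mathrm{op}$ with $r$ operands. *Algebraic:* $\mathtt{SWAP1}\,\mathrm{op}\to\mathrm{op}$ for $\mathrm{op}\in\{\mathtt{ADD},\mathtt{MUL},\mathtt{AND},\mathtt{OR},\mathtt{XOR},\mathtt{EQ},\mathtt{ADDMOD},\mathtt{MULMOD}\}$; $\mathtt{SWAP1}\,\mathtt{LT}\to\mathtt{GT}$, $\mathtt{SWAP1}\,\mathtt{GT}\to\mathtt{LT}$ and likewise for $\mathtt{SLT},\mathtt{SGT}$; constant folding $\mathtt{PUSH}\,x\,\mathrm{op}\to\mathtt{PUSH}\,\mathrm{op}(x)$ and $\mathtt{PUSH}\,y\,\mathtt{PUSH}\,x\,\mathrm{op}\to\mathtt{PUSH}\,\mathrm{op}(x,y)$ for unary and binary $\mathrm{op}$; $\mathtt{PUSH}\,x\,\mathrm{op}\,\mathtt{PUSH}\,y\,\mathrm{op}\to\mathtt{PUSH}\,\mathrm{op}(x,y)\,\mathrm{op}$ for $\mathrm{op}\in\{\mathtt{ADD},\mathtt{MUL},\mathtt{AND},\mathtt{OR},\mathtt{XOR}\}$;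 $\mathtt{PUSH}\,0\,\mathrm{op}\to\varepsilon$ for $\mathrm{op}\in\{\mathtt{ADD},\mathtt{OR},\mathtt{XOR},\mathtt{SHL},\mathtt{SHR},\mathtt{SAR}\}$; $\mathtt{PUSH}\,0\,\mathtt{SWAP1}\,\mathtt{SUB}\to\varepsilon$; $\mathtt{PUSH}\,1\,\mathtt{MUL}\to\varepsilon$; $\mathtt{PUSH}\,1\,\mathtt{SWAP1}\,\mathtt{DIV}\to\varepsilon$; $\mathtt{PUSH}\,(2^{256}-1)\,\mathtt{AND}\to\varepsilon$; $\mathtt{PUSH}\,0\,\mathrm{op}\to\mathtt{POP}\,\mathtt{PUSH}\,0$ for $\mathrm{op}\in\{\mathtt{MUL},\mathtt{AND},\mathtt{DIV},\mathtt{MOD},\mathtt{GT}\}$; $\mathtt{PUSH}\,1\,\mathtt{EXP}\to\mathtt{POP}\,\mathtt{PUSH}\,1$; $\mathtt{PUSH}\,0\,\mathtt{EQ}\to\mathtt{ISZERO}$; $\mathtt{NOT}\,\mathtt{NOT}\to\varepsilon$; $\mathtt{ISZERO}^3\to\mathtt{ISZERO}$; $\mathtt{DUP1}\,\mathrm{op}\to\varepsilon$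 for $\mathrm{op}\in\{\mathtt{AND},\mathtt{OR}\}$; $\mathtt{DUP1}\,\mathrm{op}\to\mathtt{POP}\,\mathtt{PUSH}\,0$ for $\mathrm{op}\in\{\mathtt{SUB},\mathtt{XOR},\mathtt{LT},\mathtt{GT},\mathtt{SLT},\mathtt{SGT},\mathtt{MOD}\}$; $\mathtt{DUP1}\,\mathtt{EQ}\to\mathtt{POP}\,\mathtt{PUSH}\,1$; $\mathtt{DUP1}\,\mathtt{DIV}\to\mathtt{ISZERO}\,\mathtt{ISZERO}$. *Storage:* $\mathtt{SLOAD}\,\mathtt{POP}\to\mathtt{POP}$; $\mathtt{PUSH}\,k\,\mathtt{SLOAD}\,\mathtt{PUSH}\,k\,\mathtt{SSTORE}\to\varepsilon$; $\mathtt{PUSH}\,v\,\mathtt{PUSH}\,k\,\mathtt{SSTORE}\,\mathtt{PUSH}\,w\,\mathtt{PUSH}\,k\,\mathtt{SSTORE}\to\mathtt{PUSH}\,w\,\mathtt{PUSH}\,k\,\mathtt{SSTORE}$. 2. Every generated rule $p\to p_o$ is correct on the EVM: in every machine environment and for every global state $s$, if executing $p$ leads from $s$ to $s_1$, then executing $p_o$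 leads from $s$ to a state $s_2$ that coincides with $s_1$ in every component except the gas counter, and $\mathrm{gas}(s)\le\mathrm{gas}(s_2)<\mathrm{gas}(s_1)$. 3. Gas consumption is monotone: along every execution of every program, up to and including the final state, the gas counter never decreases. 4. Let $R$ be any set of generated rules, and let $P\to_R Q$ mean that $Q$ arises from $P$ by replacing one contiguous occurrence of the left side of a rule of $R$ by its right side. Then (a) $P\to_R Q$ implies that the static gas cost of $Q$ is strictly less than that of $P$; (b) exhaustive application terminates: there is no infinite sequence $P_0\to_R P_1\to_R\cdots$, and every program $P$ rewrites in finitely many steps to some program to which no rule of $R$ applies; (c) if $P\to_R^* Q$, in particular if $Q$ results from $P$ by exhaustive application, then $Q$ is a correct optimization of $P$: in every machine environment and from every global state, if $P$ halts then $Q$ halts in the same way, with the same output and the same final state apart from gas, having consumed at most as much gas; if $P$ diverges then so does $Q$; and if $P$ does not fault, then every outcome of $Q$ corresponds in this way to an outcome of $P$. -/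

import Mathlib

namespace EVM

/-! ## Words, bytes and arithmetic -/

/-- EVM machine words. -/
abbrev Word := BitVec 256

abbrev Byte := BitVec 8

/-- Names of jump destinations. -/
abbrev Label := ℕ

def boolWord (b : Bool) : Word := if b then 1 else 0

inductive UnOp
  | iszero | not

inductive BinOp
  | add | mul | sub | div | sdiv | mod | smod | exp | signextend
  | lt | gt | slt | sgt | eq
  | and | or | xor | byte | shl | shr | sar

inductive TerOp
  | addmod | mulmod

/-- Instructions that push a datum of the execution environment. -/
inductive Env0Op
  | address | origin | caller | callvalue | calldatasize | codesize | gasprice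
  | coinbase | timestamp | number | difficulty | gaslimit | returndatasize | msize

/-- Instructions that replace the top of the stack by a datum of the execution environment. -/
inductive Env1Op
  | balance | calldataload | blockhash | extcodesize | extcodehash

def evalUn : UnOp → Word → Word
  | .iszero, a => boolWord (a == 0)
  | .not, a => ~~~a

/-- `evalBin op a b`: `a` is the top of the stack, `b` the entry below it. -/
def evalBin : BinOp → Word → Word → Word
  | .add, a, b => a + b
  | .mul, a, b => a * b
  | .sub, a, b => a - b
  | .div, a, b => if b = 0 then 0 else BitVec.udiv a b
  | .sdiv, a, b => if b = 0 then 0 else BitVec.sdiv a b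
  | .mod, a, b => if b = 0 then 0 else BitVec.umod a b
  | .smod, a, b => if b = 0 then 0 else BitVec.srem a b
  | .exp, a, b => BitVec.ofNat 256 (a.toNat ^ b.toNat)
  | .signextend, a, b =>
      if a.toNat < 31 then (b.truncate (8 * (a.toNat + 1))).signExtend 256 else b
  | .lt, a, b => boolWord (decide (a.toNat < b.toNat))
  | .gt, a, b => boolWord (decide (b.toNat < a.toNat))
  | .slt, a, b => boolWord (decide (a.toInt < b.toInt))
  | .sgt, a, b => boolWord (decide (b.toInt < a.toInt))
  | .eq, a, b => boolWord (a == b)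
  | .and, a, b => a &&& b
  | .or, a, b => a ||| b
  | .xor, a, b => a ^^^ b
  | .byte, a, b => if a.toNat < 32 then (b >>> (8 * (31 - a.toNat))) &&& 255 else 0
  | .shl, a, b => if a.toNat < 256 then b <<< a.toNat else 0
  | .shr, a, b => if a.toNat < 256 then b >>> a.toNat else 0
  | .sar, a, b => b.sshiftRight a.toNat

/-- `evalTer op a b n`: `a` is the top of the stack, `n` the third entry. -/
def evalTer : TerOp → Word → Word → Word → Word
  | .addmod, a, b, n =>
      if n = 0 then 0 else BitVec.ofNat 256 ((a.toNat + b.toNat) % n.toNat)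
  | .mulmod, a, b, n =>
      if n = 0 then 0 else BitVec.ofNat 256 ((a.toNat * b.toNat) % n.toNat)

/-! ## Instructions and programs -/

/-- Instructions that run code of another account. -/
inductive ExtKind
  | call | callcode | delegatecall | staticcall | create | create2

/-- EVM instructions, with symbolic jump destinations. The argument `n` of `dup` and `swap` is
counted from `0`: `dup 0` is `DUP1` and `swap 0` is `SWAP1`. `label` is `JUMPDEST`, and
`pushLabel l` pushes the address of the destination `l`; `finish` is `STOP`. The instructions `GAS` and `PC`, which
let a program observe the gas counter or its own byte layout, are absent. -/
inductive Instr
  | push (w : Word) | pushLabel (l : Label) | pop | dup (n : Fin 16) | swap (n : Fin 16)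
  | un (op : UnOp) | bin (op : BinOp) | ter (op : TerOp) | env0 (op : Env0Op) | env1 (op : Env1Op)
  | sload | sstore
  | mload | mstore | mstore8 | sha3 | calldatacopy | codecopy | returndatacopy
  | log (n : Fin 5) | ext (k : ExtKind)
  | label (l : Label) | jump | jumpi
  | finish | ret | revert | invalid | selfdestruct

abbrev Code := List Instr

/-! ## States -/

structure LogEntry where
  topics : List Word
  data : List Byte

/-- The global state of an execution. `ext` is the state of everything outside of the running
contract, except for balances; `gas` is the amount of gas consumed so far. -/
structure State (X : Type*) where
  stack : List Word
  memory : ℕ → Byte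
  activeWords : ℕ
  storage : Word → Word
  balances : Word → Word
  logs : List LogEntry
  returnData : List Byte
  ext : X
  gas : ℕ

/-- Two states coincide in every component but the gas counter. -/
def State.EqApartGas {X : Type*} (s t : State X) : Prop :=
  ({s with gas := 0} : State X) = {t with gas := 0}

/-- The effect of running the code of another account. -/
structure ExtResult (X : Type*) where
  success : Word
  output : List Byte
  storage : Word → Word
  balances : Word → Word
  logs : List LogEntry
  ext : X
  gas : ℕ

/-- The machine environment: the data of the current message and block, the address of each jump
destination, the byte image that `CODECOPY` reads, the hash function, and the behaviour of the
other accounts. All of it is arbitrary. -/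
structure Env (X : Type*) where
  labelAddr : Label → Word
  address : Word
  origin : Word
  caller : Word
  callValue : Word
  callData : List Byte
  codeImage : List Byte
  gasPrice : Word
  coinbase : Word
  timestamp : Word
  number : Word
  difficulty : Word
  gasLimit : Word
  blockHash : Word → Word
  extCodeSize : X → Word → Word
  extCodeHash : X → Word → Word
  keccak : List Byte → Word
  selfdestructSurcharge : (Word → Word) → X → Word → ℕ
  external : ExtKind → List Word → List Byte → (Word → Word) → (Word → Word) → X → ExtResult X

/-! ## Memory -/

/-- The word with the given big-endian bytes. -/
def bytesToWord (l : List Byte) : Word :=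
  BitVec.ofNat 256 (l.foldl (fun acc b => 256 * acc + b.toNat) 0)

/-- The `i`-th byte of a word, from the most significant one. -/
def wordByte (w : Word) (i : ℕ) : Byte := (w >>> (8 * (31 - i))).truncate 8

def wordToBytes (w : Word) : List Byte := (List.range 32).map (wordByte w)

/-- `size` bytes of `l` from position `off`, padded with zeros. -/
def slicePadded (l : List Byte) (off size : ℕ) : List Byte :=
  (List.range size).map fun i => l.getD (off + i) 0

def readMem (m : ℕ → Byte) (off size : ℕ) : List Byte :=
  (List.range size).map fun i => m (off + i)

def writeMem (m : ℕ → Byte) (off : ℕ) (l : List Byte) : ℕ → Byte := fun a =>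
  if off ≤ a ∧ a < off + l.length then l.getD (a - off) 0 else m a

def numWords (bytes : ℕ) : ℕ := (bytes + 31) / 32

/-- The number of active memory words after an access to `size` bytes from `off`. -/
def expandTo (active off size : ℕ) : ℕ :=
  if size = 0 then active else max active (numWords (off + size))

/-- Total gas charged for `a` active memory words. -/
def memGas (a : ℕ) : ℕ := 3 * a + a ^ 2 / 512

/-! ## Gas -/

def binGas : BinOp → ℕ
  | .mul | .div | .sdiv | .mod | .smod | .signextend => 5
  | .exp => 10
  | _ => 3

def env1Gas : Env1Op → ℕ
  | .balance => 400
  | .calldataload => 3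
  | .blockhash => 20
  | .extcodesize => 700
  | .extcodehash => 400

/-- The part of the gas cost of an instruction that does not depend on the state
(Petersburg fee schedule). -/
def baseGas : Instr → ℕ
  | .push _ | .pushLabel _ | .dup _ | .swap _ | .un _ => 3
  | .pop | .env0 _ => 2
  | .bin op => binGas op
  | .ter _ => 8
  | .env1 op => env1Gas op
  | .sload => 200
  | .sstore => 5000
  | .mload | .mstore | .mstore8 | .calldatacopy | .codecopy | .returndatacopy => 3
  | .sha3 => 30
  | .log n => 375 * (n.val + 1)
  | .ext .create | .ext .create2 => 32000
  | .ext _ => 700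
  | .label _ => 1
  | .jump => 8
  | .jumpi => 10
  | .finish | .ret | .revert | .invalid => 0
  | .selfdestruct => 5000

/-- The state-dependent part of the cost of a binary operation: `EXP` is charged per byte of the
exponent. -/
def binDynGas : BinOp → Word → ℕ
  | .exp, b => 50 * ((Nat.size b.toNat + 7) / 8)
  | _, _ => 0

/-- The state-dependent part of the cost of `SSTORE`: setting a zero slot to a nonzero value. -/
def sstoreDynGas (old new : Word) : ℕ := if old = 0 ∧ new ≠ 0 then 15000 else 0

/-- Static gas cost of a piece of code. -/
def staticGas (p : Code) : ℕ := (p.map baseGas).sum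

/-! ## Execution of one instruction -/

inductive HaltKind
  | finish | ret | revert | invalid | badJump | badCopy | selfdestruct

/-- Result of one instruction: fall through, jump to an address, halt with an output, or a stack
fault (underflow or overflow). -/
inductive Result (X : Type*)
  | next (s : State X)
  | jump (dest : Word) (s : State X)
  | halt (k : HaltKind) (output : List Byte) (s : State X)
  | fault

def stackLimit : ℕ := 1024

variable {X : Type*}

def addressOf (w : Word) : Word := BitVec.ofNat 256 (w.toNat % 2 ^ 160)

def readEnv0 (E : Env X) (s : State X) : Env0Op → Word
  | .address => E.address
  | .origin => E.origin
  | .caller => E.caller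
  | .callvalue => E.callValue
  | .calldatasize => BitVec.ofNat 256 E.callData.length
  | .codesize => BitVec.ofNat 256 E.codeImage.length
  | .gasprice => E.gasPrice
  | .coinbase => E.coinbase
  | .timestamp => E.timestamp
  | .number => E.number
  | .difficulty => E.difficulty
  | .gaslimit => E.gasLimit
  | .returndatasize => BitVec.ofNat 256 s.returnData.length
  | .msize => BitVec.ofNat 256 (32 * s.activeWords)

def readEnv1 (E : Env X) (s : State X) : Env1Op → Word → Word
  | .balance, w => s.balances (addressOf w)
  | .calldataload, w => bytesToWord (slicePadded E.callData w.toNat 32)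
  | .blockhash, w => E.blockHash w
  | .extcodesize, w => E.extCodeSize s.ext (addressOf w)
  | .extcodehash, w => E.extCodeHash s.ext (addressOf w)

/-- Continue with stack `st`, after `g` more units of gas, unless `st` exceeds the stack limit. -/
def State.continueWith (s : State X) (st : List Word) (g : ℕ) : Result X :=
  if st.length ≤ stackLimit then .next {s with stack := st, gas := s.gas + g} else .fault

/-- Access `size` bytes of memory from `off`: update the active words and charge for them. -/
def State.touch (s : State X) (off size : Word) : State X :=
  let a := expandTo s.activeWords off.toNat size.toNat
  {s with activeWords := a, gas := s.gas + (memGas a - memGas s.activeWords)}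

/-- `SWAP(n+1)`: exchange the top of the stack with the entry `n + 1` below it. -/
def swapTop (n : ℕ) : List Word → Option (List Word)
  | [] => none
  | a :: st => (st[n]?).map fun b => b :: st.set n a

/-- Copy to memory: `mem`, `src`, `size` are the operands, `data` the source. -/
def State.copy (s : State X) (i : Instr) (st : List Word) (data : List Byte)
    (mem src size : Word) : Result X :=
  let s' := s.touch mem size
  {s' with memory := writeMem s'.memory mem.toNat (slicePadded data src.toNat size.toNat)}
    |>.continueWith st (baseGas i + 3 * numWords size.toNat)

/-- Number of operands of an instruction that runs code of another account. -/
def ExtKind.arity : ExtKind → ℕ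
  | .call | .callcode => 7
  | .delegatecall | .staticcall => 6
  | .create => 3
  | .create2 => 4

/-- Position of the memory offset of the input among the operands; the size follows it. -/
def ExtKind.inputPos : ExtKind → ℕ
  | .call | .callcode => 3
  | .delegatecall | .staticcall => 2
  | .create | .create2 => 1

/-- The memory region (offset and size) that receives the output. -/
def ExtKind.outputRegion : ExtKind → List Word → Word × Word
  | .call, args | .callcode, args => (args.getD 5 0, args.getD 6 0)
  | .delegatecall, args | .staticcall, args => (args.getD 4 0, args.getD 5 0)
  | .create, _ | .create2, _ => (0, 0)

def execExt (E : Env X) (k : ExtKind) (s : State X) : Result X :=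
  if k.arity ≤ s.stack.length then
    let args := s.stack.take k.arity
    let inOff := args.getD k.inputPos 0
    let inSize := args.getD (k.inputPos + 1) 0
    let out := k.outputRegion args
    let s' := (s.touch inOff inSize).touch out.1 out.2
    let r := E.external k args (readMem s.memory inOff.toNat inSize.toNat)
      s.storage s.balances s.ext
    State.continueWith
      {s' with
        memory := writeMem s.memory out.1.toNat (r.output.take out.2.toNat)
        storage := r.storage
        balances := r.balances
        logs := s.logs ++ r.logs
        returnData := r.output
        ext := r.ext}
      (r.success :: s.stack.drop k.arity) (baseGas (.ext k) + r.gas)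
  else .fault

def execLog (n : ℕ) (g : ℕ) (s : State X) : Result X :=
  match s.stack with
  | off :: size :: st =>
      if n ≤ st.length then
        State.continueWith
          {s.touch off size with
            logs := s.logs ++ [⟨st.take n, readMem s.memory off.toNat size.toNat⟩]}
          (st.drop n) (g + 8 * size.toNat)
      else .fault
  | _ => .fault

/-- The semantics of one instruction, on the whole state. -/
def exec (E : Env X) (i : Instr) (s : State X) : Result X :=
  match i, s.stack with
  | .push w, st => s.continueWith (w :: st) (baseGas i)
  | .pushLabel l, st => s.continueWith (E.labelAddr l :: st) (baseGas i)
  | .pop, _ :: st => s.continueWith st (baseGas i)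
  | .dup n, st =>
      match st[n.val]? with
      | some a => s.continueWith (a :: st) (baseGas i)
      | none => .fault
  | .swap n, st =>
      match swapTop n.val st with
      | some st' => s.continueWith st' (baseGas i)
      | none => .fault
  | .un op, a :: st => s.continueWith (evalUn op a :: st) (baseGas i)
  | .bin op, a :: b :: st => s.continueWith (evalBin op a b :: st) (baseGas i + binDynGas op b)
  | .ter op, a :: b :: c :: st => s.continueWith (evalTer op a b c :: st) (baseGas i)
  | .env0 op, st => s.continueWith (readEnv0 E s op :: st) (baseGas i)
  | .env1 op, a :: st => s.continueWith (readEnv1 E s op a :: st) (baseGas i)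
  | .sload, k :: st => s.continueWith (s.storage k :: st) (baseGas i)
  | .sstore, k :: v :: st =>
      State.continueWith {s with storage := Function.update s.storage k v} st
        (baseGas i + sstoreDynGas (s.storage k) v)
  | .mload, off :: st =>
      (s.touch off 32).continueWith
        (bytesToWord (readMem s.memory off.toNat 32) :: st) (baseGas i)
  | .mstore, off :: v :: st =>
      State.continueWith
        {s.touch off 32 with memory := writeMem s.memory off.toNat (wordToBytes v)}
        st (baseGas i)
  | .mstore8, off :: v :: st =>
      State.continueWith
        {s.touch off 1 with memory := writeMem s.memory off.toNat [v.truncate 8]}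
        st (baseGas i)
  | .sha3, off :: size :: st =>
      (s.touch off size).continueWith
        (E.keccak (readMem s.memory off.toNat size.toNat) :: st)
        (baseGas i + 6 * numWords size.toNat)
  | .calldatacopy, mem :: src :: size :: st => s.copy i st E.callData mem src size
  | .codecopy, mem :: src :: size :: st => s.copy i st E.codeImage mem src size
  | .returndatacopy, mem :: src :: size :: st =>
      if src.toNat + size.toNat ≤ s.returnData.length then s.copy i st s.returnData mem src size
      else .halt .badCopy [] s
  | .log n, _ => execLog n.val (baseGas i) s
  | .ext k, _ => execExt E k s
  | .label _, st => s.continueWith st (baseGas i)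
  | .jump, dest :: st => .jump dest {s with stack := st, gas := s.gas + baseGas i}
  | .jumpi, dest :: c :: st =>
      if c = 0 then s.continueWith st (baseGas i)
      else .jump dest {s with stack := st, gas := s.gas + baseGas i}
  | .finish, _ => .halt .finish [] s
  | .ret, off :: size :: st =>
      .halt .ret (readMem s.memory off.toNat size.toNat) {s.touch off size with stack := st}
  | .revert, off :: size :: st =>
      .halt .revert (readMem s.memory off.toNat size.toNat) {s.touch off size with stack := st}
  | .invalid, _ => .halt .invalid [] s
  | .selfdestruct, w :: st =>
      let dst := addressOf w
      let self := addressOf E.address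
      .halt .selfdestruct []
        {s with
          stack := st
          balances := Function.update
            (Function.update s.balances dst (s.balances dst + s.balances self)) self 0
          gas := s.gas + baseGas i + E.selfdestructSurcharge s.balances s.ext dst}
  | _, _ => .fault

/-- Execute a sequence of instructions; `none` if the control leaves the sequence. -/
def execSeq (E : Env X) : Code → State X → Option (State X)
  | [], s => some s
  | i :: p, s =>
      match exec E i s with
      | .next s' => execSeq E p s'
      | _ => none

/-! ## Execution of programs -/

/-- A running program: the code that remains to be executed and the state. -/
structure Config (X : Type*) where
  rest : Code
  state : State X

/-- The outcome of a program that has halted. -/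
structure Outcome (X : Type*) where
  kind : HaltKind
  output : List Byte
  state : State X

inductive StepResult (X : Type*)
  | next (c : Config X)
  | final (o : Outcome X)
  | fault

/-- The code from the first destination with address `dest` on. -/
def findLabel (E : Env X) (dest : Word) : Code → Option Code
  | [] => none
  | .label l :: p => if E.labelAddr l = dest then some (.label l :: p) else findLabel E dest p
  | _ :: p => findLabel E dest p

/-- One step of the program `P`. Running off the end of the code is `STOP`. -/
def step (E : Env X) (P : Code) (c : Config X) : StepResult X :=
  match c.rest with
  | [] => .final ⟨.finish, [], c.state⟩
  | i :: p =>
      match exec E i c.state with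
      | .next s => .next ⟨p, s⟩
      | .jump dest s =>
          match findLabel E dest P with
          | some q => .next ⟨q, s⟩
          | none => .final ⟨.badJump, [], s⟩
      | .halt k out s => .final ⟨k, out, s⟩
      | .fault => .fault

def Reaches (E : Env X) (P : Code) : Config X → Config X → Prop :=
  Relation.ReflTransGen fun c c' => step E P c = .next c'

/-- The program `P`, started in state `s`, halts with outcome `o`. -/
def Halts (E : Env X) (P : Code) (s : State X) (o : Outcome X) : Prop :=
  ∃ c, Reaches E P ⟨P, s⟩ c ∧ step E P c = .final o

/-- The program `P`, started in state `s`, runs into a stack underflow or overflow. -/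
def Faults (E : Env X) (P : Code) (s : State X) : Prop :=
  ∃ c, Reaches E P ⟨P, s⟩ c ∧ step E P c = .fault

/-- The program `P`, started in state `s`, runs forever. -/
def Diverges (E : Env X) (P : Code) (s : State X) : Prop :=
  ∃ c : ℕ → Config X, c 0 = ⟨P, s⟩ ∧ ∀ n, step E P (c n) = .next (c (n + 1))

/-! ## The model in which the optimizer searches for rules

The model knows the stack, the storage of the contract and the gas; everything else that an
instruction can read is an uninterpreted function. -/

/-- Interpretation of the uninterpreted functions. -/
structure Interp where
  label : Label → Word
  read0 : Env0Op → Word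
  read1 : Env1Op → Word → Word

structure ModelState where
  stack : List Word
  storage : Word → Word
  gas : ℕ

/-- The instructions that the model knows. -/
def InModel : Instr → Prop
  | .push _ | .pushLabel _ | .pop | .dup _ | .swap _ | .un _ | .bin _ | .ter _ | .env0 _
  | .env1 _ | .sload | .sstore => True
  | _ => False

/-- Stack, storage and state-dependent gas after one instruction, before the test for a stack
overflow. -/
def modelEffect (I : Interp) (i : Instr) (st : List Word) (sto : Word → Word) :
    Option (List Word × (Word → Word) × ℕ) :=
  match i, st with
  | .push w, st => some (w :: st, sto, 0)
  | .pushLabel l, st => some (I.label l :: st, sto, 0)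
  | .pop, _ :: st => some (st, sto, 0)
  | .dup n, st => (st[n.val]?).map fun a => (a :: st, sto, 0)
  | .swap n, st => (swapTop n.val st).map fun st' => (st', sto, 0)
  | .un op, a :: st => some (evalUn op a :: st, sto, 0)
  | .bin op, a :: b :: st => some (evalBin op a b :: st, sto, binDynGas op b)
  | .ter op, a :: b :: c :: st => some (evalTer op a b c :: st, sto, 0)
  | .env0 op, st => some (I.read0 op :: st, sto, 0)
  | .env1 op, a :: st => some (I.read1 op a :: st, sto, 0)
  | .sload, k :: st => some (sto k :: st, sto, 0)
  | .sstore, k :: v :: st => some (st, Function.update sto k v, sstoreDynGas (sto k) v)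
  | _, _ => none

/-- Execution in the model; `none` is exceptional halting. -/
def modelRun (I : Interp) : Code → ModelState → Option ModelState
  | [], m => some m
  | i :: p, m =>
      match modelEffect I i m.stack m.storage with
      | some (st, sto, g) =>
          if st.length ≤ stackLimit then
            modelRun I p ⟨st, sto, m.gas + baseGas i + g⟩
          else none
      | none => none

/-! ## Rewrite rules -/

/-- A rewrite rule replaces the sequence `lhs` by `rhs`. A schematic rule is the family of its
instances. -/
structure Rule where
  lhs : Code
  rhs : Code

/-- The rules that the optimizer may produce: in the model, `rhs` is observationally equivalent to
`lhs` wherever `lhs` runs without exceptional halting, and it is strictly cheaper, both in the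
gas consumed by such a run and in the static cost. Nothing is required of the parts of the state
that the model lacks. -/
structure Generated (ρ : Rule) : Prop where
  lhs_inModel : ∀ i ∈ ρ.lhs, InModel i
  rhs_inModel : ∀ i ∈ ρ.rhs, InModel i
  equiv : ∀ (I : Interp) (m m₁ : ModelState), m.stack.length ≤ stackLimit →
    modelRun I ρ.lhs m = some m₁ →
    ∃ m₂, modelRun I ρ.rhs m = some m₂ ∧ m₂.stack = m₁.stack ∧ m₂.storage = m₁.storage ∧
      m₂.gas < m₁.gas
  cheaper : staticGas ρ.rhs < staticGas ρ.lhs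

/-- Correctness of a rule on the EVM: if the original sequence runs from `s` to `s₁`, then the
optimized one runs from `s` to a state that coincides with `s₁` apart from the gas, and consumes
strictly less gas. -/
def RuleCorrect (X : Type*) (ρ : Rule) : Prop :=
  ∀ (E : Env X) (s s₁ : State X), s.stack.length ≤ stackLimit →
    execSeq E ρ.lhs s = some s₁ →
    ∃ s₂, execSeq E ρ.rhs s = some s₂ ∧ s₂.EqApartGas s₁ ∧ s.gas ≤ s₂.gas ∧ s₂.gas < s₁.gas

/-- One application of a rule of `R` somewhere in a program. -/
inductive Rewrites (R : Set Rule) : Code → Code → Prop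
  | intro (ρ : Rule) (hρ : ρ ∈ R) (u v : Code) :
      Rewrites R (u ++ ρ.lhs ++ v) (u ++ ρ.rhs ++ v)

/-- `Q` results from `P` by exhaustive application of rules of `R`, in some order. -/
def ExhaustivelyRewrites (R : Set Rule) (P Q : Code) : Prop :=
  Relation.ReflTransGen (Rewrites R) P Q ∧ ¬ ∃ Q', Rewrites R Q Q'

/-- The outcome `o₂` coincides with `o₁` apart from the gas, of which no more is consumed. -/
def Outcome.Refines (o₂ o₁ : Outcome X) : Prop :=
  o₂.kind = o₁.kind ∧ o₂.output = o₁.output ∧ o₂.state.EqApartGas o₁.state ∧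
    o₂.state.gas ≤ o₁.state.gas

/-- The program `Q` is a correct optimization of `P`. Nothing is claimed of runs in which `P`
itself has a stack underflow or overflow. -/
structure ProgramCorrect (X : Type*) (P Q : Code) : Prop where
  halts : ∀ (E : Env X) (s : State X) (o : Outcome X), s.stack.length ≤ stackLimit →
    Halts E P s o →
    ∃ o', Halts E Q s o' ∧ o'.Refines o
  diverges : ∀ (E : Env X) (s : State X), s.stack.length ≤ stackLimit →
    Diverges E P s → Diverges E Q s
  halts_of_halts : ∀ (E : Env X) (s : State X) (o' : Outcome X), s.stack.length ≤ stackLimit →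
    ¬ Faults E P s → Halts E Q s o' → ∃ o, Halts E P s o ∧ o'.Refines o

/-! ## A catalogue of rules -/

/-- Concrete rules, stack-based, algebraic, and about the storage. -/
inductive Catalogue : Rule → Prop
  | dup_swap (n : Fin 16) : Catalogue ⟨[.dup n, .swap n], [.dup n]⟩
  | push_pop (w : Word) : Catalogue ⟨[.push w, .pop], []⟩
  | pushLabel_pop (l : Label) : Catalogue ⟨[.pushLabel l, .pop], []⟩
  | dup_pop (n : Fin 16) : Catalogue ⟨[.dup n, .pop], []⟩
  | swap_swap (n : Fin 16) : Catalogue ⟨[.swap n, .swap n], []⟩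
  | swap_pop_pop : Catalogue ⟨[.swap 0, .pop, .pop], [.pop, .pop]⟩
  | swap_dup_swap : Catalogue ⟨[.swap 0, .dup 1, .swap 0], [.dup 0, .swap 1]⟩
  | un_pop (op : UnOp) : Catalogue ⟨[.un op, .pop], [.pop]⟩
  | bin_pop (op : BinOp) : Catalogue ⟨[.bin op, .pop], [.pop, .pop]⟩
  | ter_pop (op : TerOp) : Catalogue ⟨[.ter op, .pop], [.pop, .pop, .pop]⟩
  | env0_pop (op : Env0Op) : Catalogue ⟨[.env0 op, .pop], []⟩
  | env1_pop (op : Env1Op) : Catalogue ⟨[.env1 op, .pop], [.pop]⟩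
  | swap_comm (op : BinOp) (h : op ∈ [.add, .mul, .and, .or, .xor, .eq]) :
      Catalogue ⟨[.swap 0, .bin op], [.bin op]⟩
  | swap_ter (op : TerOp) : Catalogue ⟨[.swap 0, .ter op], [.ter op]⟩
  | swap_lt : Catalogue ⟨[.swap 0, .bin .lt], [.bin .gt]⟩
  | swap_gt : Catalogue ⟨[.swap 0, .bin .gt], [.bin .lt]⟩
  | swap_slt : Catalogue ⟨[.swap 0, .bin .slt], [.bin .sgt]⟩
  | swap_sgt : Catalogue ⟨[.swap 0, .bin .sgt], [.bin .slt]⟩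
  | fold_un (op : UnOp) (a : Word) : Catalogue ⟨[.push a, .un op], [.push (evalUn op a)]⟩
  | fold_bin (op : BinOp) (a b : Word) :
      Catalogue ⟨[.push b, .push a, .bin op], [.push (evalBin op a b)]⟩
  | assoc (op : BinOp) (h : op ∈ [.add, .mul, .and, .or, .xor]) (a b : Word) :
      Catalogue ⟨[.push a, .bin op, .push b, .bin op], [.push (evalBin op a b), .bin op]⟩
  | zero_neutral (op : BinOp) (h : op ∈ [.add, .or, .xor, .shl, .shr, .sar]) :
      Catalogue ⟨[.push 0, .bin op], []⟩
  | sub_zero : Catalogue ⟨[.push 0, .swap 0, .bin .sub], []⟩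
  | one_mul : Catalogue ⟨[.push 1, .bin .mul], []⟩
  | div_one : Catalogue ⟨[.push 1, .swap 0, .bin .div], []⟩
  | ones_and : Catalogue ⟨[.push (BitVec.allOnes 256), .bin .and], []⟩
  | zero_absorbing (op : BinOp) (h : op ∈ [.mul, .and, .div, .mod, .gt]) :
      Catalogue ⟨[.push 0, .bin op], [.pop, .push 0]⟩
  | one_exp : Catalogue ⟨[.push 1, .bin .exp], [.pop, .push 1]⟩
  | zero_eq : Catalogue ⟨[.push 0, .bin .eq], [.un .iszero]⟩
  | not_not : Catalogue ⟨[.un .not, .un .not], []⟩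
  | iszero_iszero_iszero :
      Catalogue ⟨[.un .iszero, .un .iszero, .un .iszero], [.un .iszero]⟩
  | idempotent (op : BinOp) (h : op ∈ [.and, .or]) : Catalogue ⟨[.dup 0, .bin op], []⟩
  | dup_zero (op : BinOp) (h : op ∈ [.sub, .xor, .lt, .gt, .slt, .sgt, .mod]) :
      Catalogue ⟨[.dup 0, .bin op], [.pop, .push 0]⟩
  | dup_eq : Catalogue ⟨[.dup 0, .bin .eq], [.pop, .push 1]⟩
  | dup_div : Catalogue ⟨[.dup 0, .bin .div], [.un .iszero, .un .iszero]⟩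
  | sload_pop : Catalogue ⟨[.sload, .pop], [.pop]⟩
  | sload_sstore (k : Word) : Catalogue ⟨[.push k, .sload, .push k, .sstore], []⟩
  | sstore_sstore (k v w : Word) :
      Catalogue ⟨[.push v, .push k, .sstore, .push w, .push k, .sstore],
        [.push w, .push k, .sstore]⟩

end EVM

namespace EVM

/-! ## Execution of one instruction and the gas counter -/

section Exec

variable {X : Type*}

/-- The state with `d` more units of gas consumed. -/
def State.addGas (s : State X) (d : ℕ) : State X := {s with gas := s.gas + d}

def Result.addGas (d : ℕ) : Result X → Result X
  | .next s => .next (s.addGas d)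
  | .jump w s => .jump w (s.addGas d)
  | .halt k out s => .halt k out (s.addGas d)
  | .fault => .fault

/-- `Q` holds of the state in which an instruction ends, if it does not fault. -/
def Result.All (Q : State X → Prop) : Result X → Prop
  | .next s | .jump _ s | .halt _ _ s => Q s
  | .fault => True

theorem State.continueWith_addGas {s t : State X} {d : ℕ} (h : t = s.addGas d) (st : List Word)
    (g : ℕ) : t.continueWith st g = (s.continueWith st g).addGas d := by
  subst h
  unfold State.continueWith
  split_ifs
  · simp [Result.addGas, State.addGas, Nat.add_right_comm]
  · rfl

theorem State.touch_addGas (s : State X) (off size : Word) (d : ℕ) :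
    (s.addGas d).touch off size = (s.touch off size).addGas d := by
  simp [State.touch, State.addGas, Nat.add_right_comm]

theorem State.copy_addGas (s : State X) (i : Instr) (st : List Word) (data : List Byte)
    (mem src size : Word) (d : ℕ) :
    (s.addGas d).copy i st data mem src size = (s.copy i st data mem src size).addGas d := by
  unfold State.copy
  refine State.continueWith_addGas ?_ _ _
  simp only [State.touch_addGas]
  rfl

theorem execExt_addGas (E : Env X) (k : ExtKind) (s : State X) (d : ℕ) :
    execExt E k (s.addGas d) = (execExt E k s).addGas d := by
  unfold execExt
  by_cases h : k.arity ≤ s.stack.length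
  · rw [if_pos h, if_pos (show k.arity ≤ (s.addGas d).stack.length from h)]
    refine State.continueWith_addGas ?_ _ _
    simp only [State.touch_addGas]
    rfl
  · rw [if_neg h, if_neg (show ¬ k.arity ≤ (s.addGas d).stack.length from h)]
    rfl

theorem execLog_addGas (n g : ℕ) (s : State X) (d : ℕ) :
    execLog n g (s.addGas d) = (execLog n g s).addGas d := by
  have hs : (s.addGas d).stack = s.stack := rfl
  unfold execLog
  rw [hs]
  split
  · split_ifs
    · refine State.continueWith_addGas ?_ _ _
      simp only [State.touch_addGas]
      rfl
    · rfl
  · rfl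

/-- No instruction observes the gas counter. -/
theorem exec_addGas (E : Env X) (i : Instr) (s : State X) (d : ℕ) :
    exec E i (s.addGas d) = (exec E i s).addGas d := by
  have hs : (s.addGas d).stack = s.stack := rfl
  have hr : (s.addGas d).returnData = s.returnData := rfl
  unfold exec
  rw [hs]
  split
  case h_4 => split <;> [exact State.continueWith_addGas rfl _ _; rfl]
  case h_5 => split <;> [exact State.continueWith_addGas rfl _ _; rfl]
  case h_19 =>
    rw [hr]
    split_ifs
    · exact State.copy_addGas _ _ _ _ _ _ _ _
    · rfl
  all_goals first
    | exact State.continueWith_addGas rfl _ _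
    | exact State.continueWith_addGas (State.touch_addGas _ _ _ _) _ _
    | exact State.copy_addGas _ _ _ _ _ _ _ _
    | exact execExt_addGas _ _ _ _
    | exact execLog_addGas _ _ _ _
    | rfl
    | (refine State.continueWith_addGas ?_ _ _; rfl)
    | (refine State.continueWith_addGas ?_ _ _; simp only [State.touch_addGas]; rfl)
    | (simp [Result.addGas, State.addGas, State.touch, Nat.add_right_comm]; done)
    | (split_ifs <;> [exact State.continueWith_addGas rfl _ _;
        simp [Result.addGas, State.addGas, Nat.add_right_comm]])

/-- The gas counter has not decreased from `s` to `s'`, and the stack limit is still respected. -/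
def State.Sound (s s' : State X) : Prop :=
  s.gas ≤ s'.gas ∧ (s.stack.length ≤ stackLimit → s'.stack.length ≤ stackLimit)

theorem State.continueWith_sound {s t : State X} (h : s.gas ≤ t.gas) (st : List Word) (g : ℕ) :
    (t.continueWith st g).All s.Sound := by
  unfold State.continueWith
  split_ifs with hl
  · exact ⟨h.trans (Nat.le_add_right _ _), fun _ => hl⟩
  · trivial

theorem State.le_gas_touch (s : State X) (off size : Word) : s.gas ≤ (s.touch off size).gas :=
  Nat.le_add_right _ _

theorem State.copy_sound (s : State X) (i : Instr) (st : List Word) (data : List Byte)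
    (mem src size : Word) : (s.copy i st data mem src size).All s.Sound := by
  refine State.continueWith_sound ?_ _ _
  exact s.le_gas_touch _ _

theorem execExt_sound (E : Env X) (k : ExtKind) (s : State X) : (execExt E k s).All s.Sound := by
  unfold execExt
  split_ifs
  · refine State.continueWith_sound ?_ _ _
    exact (s.le_gas_touch _ _).trans (State.le_gas_touch _ _ _)
  · trivial

theorem execLog_sound (n g : ℕ) (s : State X) : (execLog n g s).All s.Sound := by
  unfold execLog
  split
  · split_ifs
    · refine State.continueWith_sound ?_ _ _
      exact s.le_gas_touch _ _
    · trivial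
  · trivial

theorem exec_sound (E : Env X) (i : Instr) (s : State X) : (exec E i s).All s.Sound := by
  unfold exec
  split
  case h_4 => split <;> [exact State.continueWith_sound le_rfl _ _; trivial]
  case h_5 => split <;> [exact State.continueWith_sound le_rfl _ _; trivial]
  case h_19 => split_ifs <;> [exact State.copy_sound _ _ _ _ _ _ _; exact ⟨le_rfl, id⟩]
  case h_24 hs =>
    split_ifs
    · exact State.continueWith_sound le_rfl _ _
    · refine ⟨Nat.le_add_right _ _, fun h => ?_⟩
      simp only [hs, List.length_cons] at h ⊢
      omega
  all_goals first
    | exact State.continueWith_sound le_rfl _ _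
    | (refine State.continueWith_sound ?_ _ _; exact s.le_gas_touch _ _)
    | exact State.copy_sound _ _ _ _ _ _ _
    | exact execExt_sound _ _ _
    | exact execLog_sound _ _ _
    | trivial
    | exact ⟨le_rfl, id⟩
    | skip
  all_goals
    rename_i hs
    refine ⟨?_, fun h => ?_⟩
    · first
        | exact Nat.le_add_right _ _
        | exact (Nat.le_add_right _ _).trans (Nat.le_add_right _ _)
    · simp only [hs, List.length_cons] at h ⊢
      omega

end Exec

/-! ## The search model and the full state -/

section Model

variable {X : Type*}

/-- The interpretation of the uninterpreted functions given by a machine environment and a state. -/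
def interpOf (E : Env X) (s : State X) : Interp := ⟨E.labelAddr, readEnv0 E s, readEnv1 E s⟩

/-- Replace the components of `s` that the model knows. -/
def State.withModel (s : State X) (m : ModelState) : State X :=
  {s with stack := m.stack, storage := m.storage, gas := m.gas}

theorem interpOf_withModel (E : Env X) (s : State X) (m : ModelState) :
    interpOf E (s.withModel m) = interpOf E s :=
  rfl

theorem exec_eq_modelEffect (E : Env X) (i : Instr) (s : State X) (hi : InModel i) :
    exec E i s = match modelEffect (interpOf E s) i s.stack s.storage with
      | some (st, sto, g) => State.continueWith {s with storage := sto} st (baseGas i + g)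
      | none => .fault := by
  obtain ⟨st, mem, act, sto, bal, logs, rd, ext, gas⟩ := s
  cases i with
  | dup n => cases h : st[n.val]? <;> simp [exec, modelEffect, h]
  | swap n => cases h : swapTop n.val st <;> simp [exec, modelEffect, h]
  | push | pushLabel | env0 => rfl
  | pop | un | env1 | sload => cases st <;> rfl
  | bin | sstore => rcases st with _ | ⟨a, _ | ⟨b, st⟩⟩ <;> rfl
  | ter => rcases st with _ | ⟨a, _ | ⟨b, _ | ⟨c, st⟩⟩⟩ <;> rfl
  | _ => exact hi.elim

/-- On instructions of the model, an execution on the full state is one in the model. -/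
theorem execSeq_withModel (E : Env X) (s : State X) (p : Code) (hp : ∀ i ∈ p, InModel i)
    (m : ModelState) :
    execSeq E p (s.withModel m) = (modelRun (interpOf E s) p m).map s.withModel := by
  induction p generalizing m with
  | nil => rfl
  | cons i p ih =>
    have ih := ih fun j hj => hp j (List.mem_cons_of_mem _ hj)
    simp only [execSeq, modelRun]
    rw [exec_eq_modelEffect E i _ (hp i List.mem_cons_self), interpOf_withModel]
    change (match (match modelEffect (interpOf E s) i m.stack m.storage with
      | some (st, sto, g) => State.continueWith {s.withModel m with storage := sto} st (baseGas i + g)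
      | none => .fault) with
      | .next s' => execSeq E p s'
      | _ => none) = _
    rcases modelEffect (interpOf E s) i m.stack m.storage with _ | ⟨st, sto, g⟩
    · rfl
    · by_cases hl : st.length ≤ stackLimit
      · simp only [State.continueWith, if_pos hl]
        rw [← ih, ← Nat.add_assoc]
        rfl
      · simp only [State.continueWith, if_neg hl]
        rfl

theorem gas_le_of_modelRun {I : Interp} {p : Code} {m m' : ModelState}
    (h : modelRun I p m = some m') : m.gas ≤ m'.gas := by
  induction p generalizing m with
  | nil => exact (congrArg ModelState.gas (Option.some.inj h)).le
  | cons i p ih =>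
    simp only [modelRun] at h
    split at h
    · split_ifs at h
      have := ih h
      simp only at this
      omega
    · cases h

/-- Rules that are valid in the model are valid on the full state. -/
theorem Generated.ruleCorrect {ρ : Rule} (hρ : Generated ρ) : RuleCorrect X ρ := by
  intro E s s₁ hs h
  have hm : s = s.withModel ⟨s.stack, s.storage, s.gas⟩ := rfl
  rw [hm, execSeq_withModel E s _ hρ.lhs_inModel, Option.map_eq_some_iff] at h
  obtain ⟨m₁, h₁, rfl⟩ := h
  obtain ⟨m₂, h₂, hst, hsto, hg⟩ := hρ.equiv _ _ _ hs h₁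
  refine ⟨s.withModel m₂, ?_, ?_, gas_le_of_modelRun h₂, hg⟩
  · conv_lhs => rw [hm]
    rw [execSeq_withModel E s _ hρ.rhs_inModel, h₂]
    rfl
  · simp [State.EqApartGas, State.withModel, hst, hsto]

end Model

/-! ## The catalogue -/

section Catalogue

theorem swapTop_self {n : ℕ} {st : List Word} {a : Word} (h : st[n]? = some a) :
    swapTop n (a :: st) = some (a :: st) := by
  obtain ⟨hn, rfl⟩ := List.getElem?_eq_some_iff.1 h
  simp [swapTop]

theorem swapTop_swapTop {n : ℕ} {st st' : List Word} (h : swapTop n st = some st') :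
    swapTop n st' = some st := by
  rcases st with _ | ⟨a, st⟩
  · simp [swapTop] at h
  · simp only [swapTop, Option.map_eq_some_iff] at h
    obtain ⟨b, hb, rfl⟩ := h
    obtain ⟨hn, rfl⟩ := List.getElem?_eq_some_iff.1 hb
    simp [swapTop, hn]

/-- `Generated` for a rule whose effect is known on every stack. -/
theorem generated_of_forall {p q : Code} (hp : ∀ i ∈ p, InModel i) (hq : ∀ i ∈ q, InModel i)
    (hc : staticGas q < staticGas p)
    (h : ∀ (I : Interp) (st : List Word) (sto : Word → Word) (g : ℕ) (m₁ : ModelState),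
      st.length ≤ stackLimit → modelRun I p ⟨st, sto, g⟩ = some m₁ →
      ∃ g₂, modelRun I q ⟨st, sto, g⟩ = some ⟨m₁.stack, m₁.storage, g₂⟩ ∧ g₂ < m₁.gas) :
    Generated ⟨p, q⟩ where
  lhs_inModel := hp
  rhs_inModel := hq
  cheaper := hc
  equiv I m m₁ hm h₁ := by
    obtain ⟨g₂, h₂, hg⟩ := h I m.stack m.storage m.gas m₁ hm h₁
    exact ⟨_, h₂, rfl, rfl, hg⟩

theorem three_le_binGas (op : BinOp) : 3 ≤ binGas op := by cases op <;> simp [binGas]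

theorem two_lt_env1Gas (op : Env1Op) : 2 < env1Gas op := by cases op <;> simp [env1Gas]

theorem sstoreDynGas_le_add (u v w : Word) :
    sstoreDynGas u w ≤ sstoreDynGas u v + sstoreDynGas v w := by
  unfold sstoreDynGas
  grind

theorem generated_swap_bin {op op' : BinOp} (h : ∀ a b, evalBin op b a = evalBin op' a b)
    (hg : binGas op' ≤ binGas op) (hd : ∀ a b, binDynGas op' b ≤ binDynGas op a) :
    Generated ⟨[.swap 0, .bin op], [.bin op']⟩ := by
  refine generated_of_forall (by simp [InModel]) (by simp [InModel])
    (by simp [staticGas, baseGas]; omega) ?_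
  intro I st sto g m₁ hst h₁
  rcases st with _ | ⟨a, _ | ⟨b, st⟩⟩ <;> simp [modelRun, modelEffect, swapTop] at h₁ ⊢
  obtain ⟨hl, hl', rfl⟩ := h₁
  have := hd a b
  refine ⟨⟨hl', by simp [h], rfl⟩, ?_⟩
  simp [baseGas]
  omega

theorem generated_push_bin_nil {op : BinOp} {a : Word} (h : ∀ b, evalBin op a b = b) :
    Generated ⟨[.push a, .bin op], []⟩ := by
  have := three_le_binGas op
  refine generated_of_forall (by simp [InModel]) (by simp [InModel])
    (by simp [staticGas, baseGas]) ?_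
  intro I st sto g m₁ hst h₁
  rcases st with _ | ⟨b, st⟩ <;> simp [modelRun, modelEffect, h] at h₁ hst ⊢
  obtain ⟨-, -, rfl⟩ := h₁
  simp [baseGas]
  omega

theorem generated_push_swap_bin_nil {op : BinOp} {a : Word} (h : ∀ b, evalBin op b a = b) :
    Generated ⟨[.push a, .swap 0, .bin op], []⟩ := by
  have := three_le_binGas op
  refine generated_of_forall (by simp [InModel]) (by simp [InModel])
    (by simp [staticGas, baseGas]) ?_
  intro I st sto g m₁ hst h₁
  rcases st with _ | ⟨b, st⟩ <;> simp [modelRun, modelEffect, swapTop, h] at h₁ hst ⊢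
  obtain ⟨-, -, rfl⟩ := h₁
  simp [baseGas]
  omega

theorem generated_push_bin_const {op : BinOp} {a c : Word} (h : ∀ b, evalBin op a b = c) :
    Generated ⟨[.push a, .bin op], [.pop, .push c]⟩ := by
  have := three_le_binGas op
  refine generated_of_forall (by simp [InModel]) (by simp [InModel])
    (by simp [staticGas, baseGas]; omega) ?_
  intro I st sto g m₁ hst h₁
  rcases st with _ | ⟨b, st⟩ <;> simp [modelRun, modelEffect, h] at h₁ hst ⊢
  obtain ⟨-, -, rfl⟩ := h₁
  simp [baseGas]
  omega

theorem generated_dup_bin_nil {op : BinOp} (h : ∀ b, evalBin op b b = b) :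
    Generated ⟨[.dup 0, .bin op], []⟩ := by
  have := three_le_binGas op
  refine generated_of_forall (by simp [InModel]) (by simp [InModel])
    (by simp [staticGas, baseGas]) ?_
  intro I st sto g m₁ hst h₁
  rcases st with _ | ⟨b, st⟩ <;> simp [modelRun, modelEffect, h] at h₁ hst ⊢
  obtain ⟨-, -, rfl⟩ := h₁
  simp [baseGas]
  omega

theorem generated_dup_bin_const {op : BinOp} {c : Word} (h : ∀ b, evalBin op b b = c) :
    Generated ⟨[.dup 0, .bin op], [.pop, .push c]⟩ := by
  have := three_le_binGas op
  refine generated_of_forall (by simp [InModel]) (by simp [InModel])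
    (by simp [staticGas, baseGas]; omega) ?_
  intro I st sto g m₁ hst h₁
  rcases st with _ | ⟨b, st⟩ <;> simp [modelRun, modelEffect, h] at h₁ hst ⊢
  obtain ⟨-, -, rfl⟩ := h₁
  simp [baseGas]
  omega

theorem generated_assoc {op : BinOp} (h : ∀ a b c, evalBin op b (evalBin op a c) =
    evalBin op (evalBin op a b) c) (hd : ∀ b, binDynGas op b = 0) (a b : Word) :
    Generated ⟨[.push a, .bin op, .push b, .bin op], [.push (evalBin op a b), .bin op]⟩ := by
  refine generated_of_forall (by simp [InModel]) (by simp [InModel])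
    (by simp [staticGas, baseGas]) ?_
  intro I st sto g m₁ hst h₁
  rcases st with _ | ⟨c, st⟩ <;> simp [modelRun, modelEffect, h, hd] at h₁ hst ⊢
  obtain ⟨h₂, -, -, -, rfl⟩ := h₁
  simp [baseGas]
  omega

theorem Catalogue.generated {ρ : Rule} (h : Catalogue ρ) : Generated ρ := by
  cases h with
  | dup_swap n =>
    refine generated_of_forall (by simp [InModel]) (by simp [InModel])
      (by simp [staticGas, baseGas]) ?_
    intro I st sto g m₁ hst h
    rcases ha : st[n.val]? with _ | a <;>
      simp [modelRun, modelEffect, ha, swapTop_self] at h ⊢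
    obtain ⟨hl, rfl⟩ := h
    simp [baseGas, hl]
  | dup_pop n =>
    refine generated_of_forall (by simp [InModel]) (by simp)
      (by simp [staticGas, baseGas]) ?_
    intro I st sto g m₁ hst h
    rcases ha : st[n.val]? with _ | a <;> simp [modelRun, modelEffect, ha] at h ⊢
    obtain ⟨-, -, rfl⟩ := h
    simp [baseGas]
    omega
  | swap_swap n =>
    refine generated_of_forall (by simp [InModel]) (by simp)
      (by simp [staticGas, baseGas]) ?_
    intro I st sto g m₁ hst h
    rcases hs : swapTop n.val st with _ | st' <;> simp [modelRun, modelEffect, hs] at h ⊢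
    simp [swapTop_swapTop hs] at h
    obtain ⟨-, -, rfl⟩ := h
    simp [baseGas]
    omega
  | swap_comm op ho =>
    simp at ho
    rcases ho with rfl | rfl | rfl | rfl | rfl | rfl <;>
      refine generated_swap_bin (fun a b => ?_) le_rfl fun _ _ => le_rfl
    · exact BitVec.add_comm _ _
    · exact BitVec.mul_comm _ _
    · exact BitVec.and_comm _ _
    · exact BitVec.or_comm _ _
    · exact BitVec.xor_comm _ _
    · exact congrArg boolWord BEq.comm
  | swap_lt | swap_gt | swap_slt | swap_sgt =>
    exact generated_swap_bin (fun _ _ => rfl) le_rfl fun _ _ => le_rfl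
  | assoc op ho a b =>
    simp at ho
    rcases ho with rfl | rfl | rfl | rfl | rfl <;>
      refine generated_assoc (fun a b c => ?_) (fun _ => rfl) a b <;> simp only [evalBin]
    · rw [BitVec.add_comm a b, BitVec.add_assoc]
    · rw [BitVec.mul_comm a b, BitVec.mul_assoc]
    · rw [BitVec.and_comm a b, BitVec.and_assoc]
    · rw [BitVec.or_comm a b, BitVec.or_assoc]
    · rw [BitVec.xor_comm a b, BitVec.xor_assoc]
  | zero_neutral op ho =>
    simp at ho
    rcases ho with rfl | rfl | rfl | rfl | rfl | rfl <;>
      exact generated_push_bin_nil fun b => by simp [evalBin]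
  | sub_zero => exact generated_push_swap_bin_nil fun b => by simp [evalBin]
  | one_mul => exact generated_push_bin_nil fun b => by simp [evalBin]
  | div_one =>
    refine generated_push_swap_bin_nil fun b => ?_
    simp [evalBin]
  | ones_and => exact generated_push_bin_nil fun b => by simp only [evalBin, BitVec.allOnes_and]
  | zero_absorbing op ho =>
    simp at ho
    rcases ho with rfl | rfl | rfl | rfl | rfl <;>
      exact generated_push_bin_const fun b => by simp [evalBin, boolWord]
  | one_exp => exact generated_push_bin_const fun b => by simp [evalBin]
  | idempotent op ho =>
    simp at ho
    rcases ho with rfl | rfl <;> exact generated_dup_bin_nil fun b => by simp [evalBin]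
  | dup_zero op ho =>
    simp at ho
    rcases ho with rfl | rfl | rfl | rfl | rfl | rfl | rfl <;>
      exact generated_dup_bin_const fun b => by simp [evalBin, boolWord]
  | dup_eq => exact generated_dup_bin_const fun b => by simp [evalBin, boolWord]
  | dup_div =>
    refine generated_of_forall (by simp [InModel]) (by simp [InModel])
      (by simp [staticGas, baseGas, binGas]) ?_
    intro I st sto g m₁ hst h
    rcases st with _ | ⟨a, st⟩ <;> simp [modelRun, modelEffect] at h hst ⊢
    obtain ⟨-, hl, rfl⟩ := h
    refine ⟨⟨hl, ?_, rfl⟩, ?_⟩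
    · by_cases ha : a = 0
      · simp [evalUn, evalBin, boolWord, ha]
      · simp [evalUn, evalBin, boolWord, BitVec.udiv_self]
    · simp [baseGas, binGas]
      omega
  | sload_sstore k =>
    refine generated_of_forall (by simp [InModel]) (by simp)
      (by simp [staticGas, baseGas]) ?_
    intro I st sto g m₁ hst h
    simp [modelRun, modelEffect] at h ⊢
    obtain ⟨-, -, -, rfl⟩ := h
    simp [baseGas]
    omega
  | sstore_sstore k v w =>
    refine generated_of_forall (by simp [InModel]) (by simp [InModel])
      (by simp [staticGas, baseGas]) ?_
    intro I st sto g m₁ hst h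
    simp [modelRun, modelEffect] at h ⊢
    obtain ⟨h₁, h₂, h₃, -, -, -, rfl⟩ := h
    refine ⟨⟨h₁, h₂, h₃, rfl, rfl⟩, ?_⟩
    have := sstoreDynGas_le_add (sto k) v w
    simp only [baseGas]
    omega
  | not_not =>
    refine generated_of_forall (by simp [InModel]) (by simp)
      (by simp [staticGas, baseGas]) ?_
    intro I st sto g m₁ hst h
    rcases st with _ | ⟨a, st⟩ <;> simp [modelRun, modelEffect, evalUn] at h hst ⊢
    obtain ⟨-, rfl⟩ := h
    simp [baseGas]
    omega
  | iszero_iszero_iszero =>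
    refine generated_of_forall (by simp [InModel]) (by simp [InModel])
      (by simp [staticGas, baseGas]) ?_
    intro I st sto g m₁ hst h
    rcases st with _ | ⟨a, st⟩ <;> simp [modelRun, modelEffect, evalUn] at h hst ⊢
    obtain ⟨hl, rfl⟩ := h
    refine ⟨⟨hl, ?_, rfl⟩, ?_⟩
    · by_cases ha : a = 0 <;> simp [boolWord, ha]
    · simp [baseGas]
  | bin_pop op =>
    have := three_le_binGas op
    refine generated_of_forall (by simp [InModel]) (by simp [InModel])
      (by simp [staticGas, baseGas]; omega) ?_
    intro I st sto g m₁ hst h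
    rcases st with _ | ⟨a, _ | ⟨b, st⟩⟩ <;> simp [modelRun, modelEffect] at h hst ⊢
    obtain ⟨h₁, h₂, rfl⟩ := h
    simp [baseGas]
    omega
  | env1_pop op =>
    have := two_lt_env1Gas op
    refine generated_of_forall (by simp [InModel]) (by simp [InModel])
      (by simp [staticGas, baseGas]; omega) ?_
    intro I st sto g m₁ hst h
    rcases st with _ | ⟨a, st⟩ <;> simp [modelRun, modelEffect] at h hst ⊢
    obtain ⟨h₁, h₂, rfl⟩ := h
    simp [baseGas]
    omega
  | push_pop w | pushLabel_pop l | env0_pop op =>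
    refine generated_of_forall (by simp [InModel]) (by simp [InModel])
      (by simp [staticGas, baseGas]) ?_
    intro I st sto g m₁ hst h
    simp [modelRun, modelEffect] at h hst ⊢
    obtain ⟨-, -, rfl⟩ := h
    simp [baseGas]
    omega
  | fold_un op a =>
    refine generated_of_forall (by simp [InModel]) (by simp [InModel])
      (by simp [staticGas, baseGas]) ?_
    intro I st sto g m₁ hst h
    simp [modelRun, modelEffect] at h hst ⊢
    obtain ⟨h₁, -, rfl⟩ := h
    simp [baseGas]
    omega
  | fold_bin op a b =>
    have := three_le_binGas op
    refine generated_of_forall (by simp [InModel]) (by simp [InModel])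
      (by simp [staticGas, baseGas]) ?_
    intro I st sto g m₁ hst h
    simp [modelRun, modelEffect] at h hst ⊢
    obtain ⟨h₁, -, -, rfl⟩ := h
    simp [baseGas]
    omega
  | un_pop op | sload_pop =>
    refine generated_of_forall (by simp [InModel]) (by simp [InModel])
      (by simp [staticGas, baseGas]) ?_
    intro I st sto g m₁ hst h
    rcases st with _ | ⟨a, st⟩ <;> simp [modelRun, modelEffect] at h hst ⊢
    obtain ⟨-, h₁, rfl⟩ := h
    simp [baseGas]
    omega
  | swap_pop_pop =>
    refine generated_of_forall (by simp [InModel]) (by simp [InModel])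
      (by simp [staticGas, baseGas]) ?_
    intro I st sto g m₁ hst h
    rcases st with _ | ⟨a, _ | ⟨b, st⟩⟩ <;> simp [modelRun, modelEffect, swapTop] at h hst ⊢
    obtain ⟨-, h₁, h₂, rfl⟩ := h
    simp [baseGas]
    omega
  | swap_dup_swap =>
    refine generated_of_forall (by simp [InModel]) (by simp [InModel])
      (by simp [staticGas, baseGas]) ?_
    intro I st sto g m₁ hst h
    rcases st with _ | ⟨a, _ | ⟨b, st⟩⟩ <;> simp [modelRun, modelEffect, swapTop] at h hst ⊢
    obtain ⟨-, h₁, rfl⟩ := h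
    simp [baseGas]
    omega
  | ter_pop op =>
    refine generated_of_forall (by simp [InModel]) (by simp [InModel])
      (by simp [staticGas, baseGas]) ?_
    intro I st sto g m₁ hst h
    rcases st with _ | ⟨a, _ | ⟨b, _ | ⟨c, st⟩⟩⟩ <;> simp [modelRun, modelEffect] at h hst ⊢
    obtain ⟨h₁, h₂, rfl⟩ := h
    simp [baseGas]
    omega
  | swap_ter op =>
    refine generated_of_forall (by simp [InModel]) (by simp [InModel])
      (by simp [staticGas, baseGas]) ?_
    intro I st sto g m₁ hst h
    rcases st with _ | ⟨a, _ | ⟨b, _ | ⟨c, st⟩⟩⟩ <;> simp [modelRun, modelEffect, swapTop] at h hst ⊢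
    obtain ⟨-, h₁, rfl⟩ := h
    refine ⟨⟨h₁, ?_, rfl⟩, by simp [baseGas]⟩
    cases op <;> simp [evalTer, Nat.add_comm, Nat.mul_comm]
  | zero_eq =>
    refine generated_of_forall (by simp [InModel]) (by simp [InModel])
      (by simp [staticGas, baseGas, binGas]) ?_
    intro I st sto g m₁ hst h
    rcases st with _ | ⟨a, st⟩ <;> simp [modelRun, modelEffect] at h hst ⊢
    obtain ⟨-, h₁, rfl⟩ := h
    refine ⟨⟨h₁, ?_, rfl⟩, by simp [baseGas, binGas]; omega⟩
    exact congrArg (fun b => boolWord b :: st) BEq.comm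

end Catalogue

/-! ## Runs of programs -/

section Runs

variable {X : Type*} {E : Env X} {P Q : Code}

def HaltsFrom (E : Env X) (P : Code) (c : Config X) (o : Outcome X) : Prop :=
  ∃ d, Reaches E P c d ∧ step E P d = .final o

def FaultsFrom (E : Env X) (P : Code) (c : Config X) : Prop :=
  ∃ d, Reaches E P c d ∧ step E P d = .fault

/-- The run of `P` from `c` is finite. -/
def Terminates (E : Env X) (P : Code) (c : Config X) : Prop :=
  Acc (fun d' d => step E P d = .next d') c

theorem steps_rightUnique (E : Env X) (P : Code) :
    Relator.RightUnique fun c c' : Config X => step E P c = .next c' := by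
  intro a b c hb hc
  exact StepResult.next.inj (hb.symm.trans hc)

theorem eq_of_reaches_of_step {c d : Config X} (h : Reaches E P c d)
    (hc : ∀ c', step E P c ≠ .next c') : c = d := by
  rcases h.cases_head with h | ⟨c', h, -⟩
  · exact h
  · exact (hc c' h).elim

/-- Two ends of the same run coincide. -/
theorem Reaches.end_unique {c d d' : Config X} (h : Reaches E P c d) (h' : Reaches E P c d')
    (hd : ∀ e, step E P d ≠ .next e) (hd' : ∀ e, step E P d' ≠ .next e) : d = d' := by
  rcases Relation.ReflTransGen.total_of_right_unique (steps_rightUnique E P) h h' with h | h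
  · exact eq_of_reaches_of_step h hd
  · exact (eq_of_reaches_of_step h hd').symm

theorem HaltsFrom.unique {c : Config X} {o o' : Outcome X} (h : HaltsFrom E P c o)
    (h' : HaltsFrom E P c o') : o = o' := by
  obtain ⟨d, hd, hs⟩ := h
  obtain ⟨d', hd', hs'⟩ := h'
  obtain rfl := hd.end_unique hd' (by simp [hs]) (by simp [hs'])
  exact StepResult.final.inj (hs.symm.trans hs')

theorem HaltsFrom.not_faultsFrom {c : Config X} {o : Outcome X} (h : HaltsFrom E P c o) :
    ¬ FaultsFrom E P c := by
  rintro ⟨d', hd', hs'⟩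
  obtain ⟨d, hd, hs⟩ := h
  obtain rfl := hd.end_unique hd' (by simp [hs]) (by simp [hs'])
  simp [hs] at hs'

theorem terminates_of_reaches {c d : Config X} (h : Reaches E P c d)
    (hd : ∀ e, step E P d ≠ .next e) : Terminates E P c := by
  induction h using Relation.ReflTransGen.head_induction_on with
  | refl => exact ⟨_, fun e he => (hd e he).elim⟩
  | head h _ ih =>
    refine ⟨_, fun e he => ?_⟩
    obtain rfl := StepResult.next.inj (h.symm.trans he)
    exact ih

theorem HaltsFrom.terminates {c : Config X} {o : Outcome X} (h : HaltsFrom E P c o) :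
    Terminates E P c := by
  obtain ⟨d, hd, hs⟩ := h
  exact terminates_of_reaches hd (by simp [hs])

theorem FaultsFrom.terminates {c : Config X} (h : FaultsFrom E P c) : Terminates E P c := by
  obtain ⟨d, hd, hs⟩ := h
  exact terminates_of_reaches hd (by simp [hs])

theorem Terminates.halts_or_faults {c : Config X} (h : Terminates E P c) :
    (∃ o, HaltsFrom E P c o) ∨ FaultsFrom E P c := by
  induction h with
  | intro c _ ih =>
    rcases hs : step E P c with d | o | _
    · rcases ih d hs with ⟨o, e, he, ho⟩ | ⟨e, he, ho⟩
      · exact .inl ⟨o, e, .head hs he, ho⟩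
      · exact .inr ⟨e, .head hs he, ho⟩
    · exact .inl ⟨o, c, .refl, hs⟩
    · exact .inr ⟨c, .refl, hs⟩

theorem diverges_iff {s : State X} : Diverges E P s ↔ ¬ Terminates E P ⟨P, s⟩ := by
  unfold Terminates
  rw [not_acc_iff_exists_descending_chain]
  rfl

theorem FaultsFrom.of_reaches {c d : Config X} (h : Reaches E P c d) (hd : FaultsFrom E P d) :
    FaultsFrom E P c := by
  obtain ⟨e, he, hs⟩ := hd
  exact ⟨e, h.trans he, hs⟩

theorem HaltsFrom.of_reaches {c d : Config X} {o : Outcome X} (h : Reaches E P c d)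
    (hd : HaltsFrom E P d o) : HaltsFrom E P c o := by
  obtain ⟨e, he, hs⟩ := hd
  exact ⟨e, h.trans he, hs⟩

/-- The last part of the correctness of an optimization follows from the first two. -/
theorem ProgramCorrect.of_halts_of_diverges
    (hh : ∀ (E : Env X) (s : State X) (o : Outcome X), s.stack.length ≤ stackLimit →
      Halts E P s o → ∃ o', Halts E Q s o' ∧ o'.Refines o)
    (hd : ∀ (E : Env X) (s : State X), s.stack.length ≤ stackLimit →
      Diverges E P s → Diverges E Q s) : ProgramCorrect X P Q where
  halts := hh
  diverges := hd
  halts_of_halts E s o' hs hf hQ := by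
    by_cases ht : Terminates E P ⟨P, s⟩
    · rcases ht.halts_or_faults with ⟨o, ho⟩ | h
      · obtain ⟨o'', ho'', hr⟩ := hh E s o hs ho
        obtain rfl := HaltsFrom.unique ho'' hQ
        exact ⟨o, ho, hr⟩
      · exact (hf h).elim
    · exact (diverges_iff.1 (hd E s hs (diverges_iff.2 ht)) (HaltsFrom.terminates hQ)).elim

theorem Outcome.Refines.trans {o₁ o₂ o₃ : Outcome X} (h : o₃.Refines o₂) (h' : o₂.Refines o₁) :
    o₃.Refines o₁ :=
  ⟨h.1.trans h'.1, h.2.1.trans h'.2.1, Eq.trans h.2.2.1 h'.2.2.1, h.2.2.2.trans h'.2.2.2⟩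

theorem ProgramCorrect.refl (P : Code) : ProgramCorrect X P P :=
  .of_halts_of_diverges (fun _ _ o _ h => ⟨o, h, rfl, rfl, rfl, le_rfl⟩) fun _ _ _ h => h

theorem ProgramCorrect.trans {P₁ P₂ P₃ : Code} (h : ProgramCorrect X P₁ P₂)
    (h' : ProgramCorrect X P₂ P₃) : ProgramCorrect X P₁ P₃ :=
  .of_halts_of_diverges
    (fun E s o hs ho => by
      obtain ⟨o₂, ho₂, hr⟩ := h.halts E s o hs ho
      obtain ⟨o₃, ho₃, hr'⟩ := h'.halts E s o₂ hs ho₂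
      exact ⟨o₃, ho₃, hr'.trans hr⟩)
    fun E s hs hd => h'.diverges E s hs (h.diverges E s hs hd)

/-! ### Monotonicity of gas -/

theorem gas_le_of_step_next {c c' : Config X} (h : step E P c = .next c') :
    c.state.gas ≤ c'.state.gas := by
  unfold step at h
  split at h
  · simp at h
  · rename_i i p hr
    have hs := exec_sound E i c.state
    split at h
    · rename_i s he
      rw [he] at hs
      obtain rfl := StepResult.next.inj h
      exact hs.1
    · rename_i dest s he
      rw [he] at hs
      split at h
      · obtain rfl := StepResult.next.inj h
        exact hs.1
      · cases h
    · cases h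
    · cases h

theorem gas_le_of_step_final {c : Config X} {o : Outcome X} (h : step E P c = .final o) :
    c.state.gas ≤ o.state.gas := by
  unfold step at h
  split at h
  · obtain rfl := StepResult.final.inj h
    exact le_rfl
  · rename_i i p hr
    have hs := exec_sound E i c.state
    split at h
    · cases h
    · rename_i dest s he
      rw [he] at hs
      split at h
      · cases h
      · obtain rfl := StepResult.final.inj h
        exact hs.1
    · rename_i k out s he
      rw [he] at hs
      obtain rfl := StepResult.final.inj h
      exact hs.1
    · cases h

theorem Reaches.gas_le {c c' : Config X} (h : Reaches E P c c') :
    c.state.gas ≤ c'.state.gas := by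
  induction h with
  | refl => exact le_rfl
  | tail _ h ih => exact ih.trans (gas_le_of_step_next h)

theorem Halts.gas_le {s : State X} {o : Outcome X} (h : Halts E P s o) : s.gas ≤ o.state.gas := by
  obtain ⟨c, hc, ho⟩ := h
  exact (Reaches.gas_le hc).trans (gas_le_of_step_final ho)

/-! ### Straight-line code -/

/-- A sequence of instructions that is executed to its end. -/
theorem reaches_of_execSeq {p v : Code} {s s' : State X} (h : execSeq E p s = some s') :
    Reaches E P ⟨p ++ v, s⟩ ⟨v, s'⟩ := by
  induction p generalizing s with
  | nil =>
    obtain rfl := Option.some.inj h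
    exact .refl
  | cons i p ih =>
    simp only [execSeq] at h
    split at h
    · rename_i s₁ he
      have hs : step E P ⟨i :: p ++ v, s⟩ = .next ⟨p ++ v, s₁⟩ := by simp [step, he]
      exact .head hs (ih h)
    · cases h

theorem exec_of_inModel {i : Instr} (hi : InModel i) (s : State X) :
    (∃ s', exec E i s = .next s') ∨ exec E i s = .fault := by
  rw [exec_eq_modelEffect E i s hi]
  rcases modelEffect (interpOf E s) i s.stack s.storage with _ | ⟨st, sto, g⟩
  · exact .inr rfl
  · unfold State.continueWith
    simp only
    split_ifs
    · exact .inl ⟨_, rfl⟩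
    · exact .inr rfl

/-- Code of the model is executed to its end or faults. -/
theorem execSeq_of_not_faultsFrom {p v : Code} (hp : ∀ i ∈ p, InModel i) {s : State X}
    (h : ¬ FaultsFrom E P ⟨p ++ v, s⟩) : ∃ s', execSeq E p s = some s' := by
  induction p generalizing s with
  | nil => exact ⟨s, rfl⟩
  | cons i p ih =>
    rcases exec_of_inModel (E := E) (hp i List.mem_cons_self) s with ⟨s', he⟩ | he
    · have hs : step E P ⟨i :: p ++ v, s⟩ = .next ⟨p ++ v, s'⟩ := by simp [step, he]
      obtain ⟨s'', h''⟩ := ih (fun j hj => hp j (List.mem_cons_of_mem _ hj))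
        fun hf => h (.of_reaches (.single hs) hf)
      exact ⟨s'', by simp [execSeq, he, h'']⟩
    · exact (h ⟨_, .refl, by simp [step, he]⟩).elim

theorem execSeq_stack_le {p : Code} {s s' : State X} (h : execSeq E p s = some s')
    (hs : s.stack.length ≤ stackLimit) : s'.stack.length ≤ stackLimit := by
  induction p generalizing s with
  | nil =>
    obtain rfl := Option.some.inj h
    exact hs
  | cons i p ih =>
    simp only [execSeq] at h
    have hx := exec_sound E i s
    split at h
    · rename_i s₁ he
      rw [he] at hx
      exact ih h (hx.2 hs)
    · cases h

theorem execSeq_addGas (p : Code) (s : State X) (d : ℕ) :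
    execSeq E p (s.addGas d) = (execSeq E p s).map fun s' => s'.addGas d := by
  induction p generalizing s with
  | nil => rfl
  | cons i p ih =>
    simp only [execSeq]
    rw [exec_addGas]
    cases exec E i s with
    | next s' => exact ih s'
    | _ => rfl

end Runs

/-! ## One rule application -/

section Simulation

variable {X : Type*} {E : Env X}

/-- Remaining code before and after the replacement of `p` by `q` in front of `v`. -/
inductive CodeRel (p q v : Code) : Code → Code → Prop
  | before (w : Code) : CodeRel p q v (w ++ p ++ v) (w ++ q ++ v)
  | after (w : Code) : CodeRel p q v w w

theorem findLabel_append_of_inModel {p : Code} (hp : ∀ i ∈ p, InModel i) (dest : Word)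
    (v : Code) : findLabel E dest (p ++ v) = findLabel E dest v := by
  induction p with
  | nil => rfl
  | cons i p ih =>
    have hi := hp i List.mem_cons_self
    rw [← ih fun j hj => hp j (List.mem_cons_of_mem _ hj)]
    cases i <;> first | rfl | exact hi.elim

theorem findLabel_rel {p q : Code} (hp : ∀ i ∈ p, InModel i) (hq : ∀ i ∈ q, InModel i)
    (dest : Word) (u v : Code) :
    Option.Rel (CodeRel p q v) (findLabel E dest (u ++ p ++ v))
      (findLabel E dest (u ++ q ++ v)) := by
  induction u with
  | nil =>
    simp only [List.nil_append]
    rw [findLabel_append_of_inModel hp, findLabel_append_of_inModel hq]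
    cases findLabel E dest v with
    | none => exact .none
    | some w => exact .some (.after w)
  | cons i u ih =>
    cases i
    case label l =>
      simp only [List.cons_append, findLabel]
      split_ifs
      · exact .some (.before (.label l :: u))
      · exact ih
    all_goals exact ih

/-- Configurations of the original and of the optimized program at corresponding points. -/
structure ConfigRel (p q v : Code) (c c' : Config X) : Prop where
  code : CodeRel p q v c.rest c'.rest
  state : ∃ d, c.state = c'.state.addGas d
  limit : c'.state.stack.length ≤ stackLimit

theorem refines_addGas (k : HaltKind) (out : List Byte) (s : State X) (d : ℕ) :
    Outcome.Refines ⟨k, out, s⟩ ⟨k, out, s.addGas d⟩ :=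
  ⟨rfl, rfl, rfl, Nat.le_add_right _ _⟩

theorem exists_addGas_of_eqApartGas {s t : State X} (h : s.EqApartGas t) (hg : s.gas ≤ t.gas) :
    ∃ d, t = s.addGas d := by
  refine ⟨t.gas - s.gas, ?_⟩
  obtain ⟨st, mem, act, sto, bal, logs, rd, ext, gas⟩ := s
  obtain ⟨st', mem', act', sto', bal', logs', rd', ext', gas'⟩ := t
  simp only [State.EqApartGas, State.mk.injEq, and_true] at h
  simp only at hg
  obtain ⟨rfl, rfl, rfl, rfl, rfl, rfl, rfl, rfl⟩ := h
  simp [State.addGas, Nat.add_sub_cancel' hg]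

/-- Both runs halt, with corresponding outcomes. -/
def BothHalt (E : Env X) (P Q : Code) (c c' : Config X) : Prop :=
  ∃ o o', HaltsFrom E P c o ∧ HaltsFrom E Q c' o' ∧ o'.Refines o

theorem BothHalt.of_reaches {P Q : Code} {c c' d d' : Config X} (h : Reaches E P c d)
    (h' : Reaches E Q c' d') (hd : BothHalt E P Q d d') : BothHalt E P Q c c' := by
  obtain ⟨o, o', ho, ho', hr⟩ := hd
  exact ⟨o, o', .of_reaches h ho, .of_reaches h' ho', hr⟩

/-- Two runs in step: they both end, with corresponding outcomes, or reach configurations related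
by `S`, each in at least one step. -/
def Advance (E : Env X) (P Q : Code) (S : Config X → Config X → Prop) (c c' : Config X) : Prop :=
  BothHalt E P Q c c' ∨
    ∃ d d', S d d' ∧ Relation.TransGen (fun a b => step E P a = .next b) c d ∧
      Relation.TransGen (fun a b => step E Q a = .next b) c' d'

theorem Advance.of_reaches {P Q : Code} {S : Config X → Config X → Prop} {c c' d d' : Config X}
    (h : Reaches E P c d) (h' : Reaches E Q c' d') (hd : Advance E P Q S d d') :
    Advance E P Q S c c' := by
  rcases hd with hd | ⟨e, e', hS, he, he'⟩
  · exact .inl (hd.of_reaches h h')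
  · exact .inr ⟨e, e', hS, .trans_right h he, .trans_right h' he'⟩

variable {p q u v : Code}

theorem advance_nil (P Q : Code) {S : Config X → Config X → Prop} (s : State X) (d : ℕ) :
    Advance E P Q S ⟨[], s.addGas d⟩ ⟨[], s⟩ :=
  .inl ⟨_, _, ⟨_, .refl, rfl⟩, ⟨_, .refl, rfl⟩, refines_addGas _ _ _ _⟩

/-- The same instruction in front of corresponding code. -/
theorem advance_cons (hp : ∀ i ∈ p, InModel i) (hq : ∀ i ∈ q, InModel i) {i : Instr} {r r' : Code}
    (hr : CodeRel p q v r r') {s : State X} {d : ℕ} (hs : s.stack.length ≤ stackLimit)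
    (hf : ¬ FaultsFrom E (u ++ p ++ v) ⟨i :: r, s.addGas d⟩) :
    Advance E (u ++ p ++ v) (u ++ q ++ v) (ConfigRel p q v) ⟨i :: r, s.addGas d⟩ ⟨i :: r', s⟩ := by
  have hx := exec_sound E i s
  have hg := exec_addGas E i s d
  rcases he : exec E i s with t | ⟨dest, t⟩ | ⟨k, out, t⟩ | _ <;> rw [he] at hx hg <;>
    simp only [Result.addGas] at hg
  · refine .inr ⟨⟨r, t.addGas d⟩, ⟨r', t⟩, ⟨hr, ⟨d, rfl⟩, hx.2 hs⟩, .single ?_, .single ?_⟩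
    · simp [step, hg]
    · simp [step, he]
  · have hl := findLabel_rel (E := E) hp hq dest u v
    rcases h₁ : findLabel E dest (u ++ p ++ v) with _ | w <;>
      rcases h₂ : findLabel E dest (u ++ q ++ v) with _ | w' <;> rw [h₁, h₂] at hl <;> cases hl
    · refine .inl ⟨⟨.badJump, [], t.addGas d⟩, ⟨.badJump, [], t⟩, ⟨_, .refl, ?_⟩, ⟨_, .refl, ?_⟩,
        refines_addGas _ _ _ _⟩
      · simp only [step, hg, h₁]
      · simp only [step, he, h₂]
    · rename_i hw
      refine .inr ⟨⟨w, t.addGas d⟩, ⟨w', t⟩, ⟨hw, ⟨d, rfl⟩, hx.2 hs⟩, .single ?_, .single ?_⟩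
      · simp only [step, hg, h₁]
      · simp only [step, he, h₂]
  · refine .inl ⟨⟨k, out, t.addGas d⟩, ⟨k, out, t⟩, ⟨_, .refl, ?_⟩, ⟨_, .refl, ?_⟩,
      refines_addGas _ _ _ _⟩
    · simp [step, hg]
    · simp [step, he]
  · exact (hf ⟨_, .refl, by simp [step, hg]⟩).elim

theorem advance_same (hp : ∀ i ∈ p, InModel i) (hq : ∀ i ∈ q, InModel i) (w : Code)
    {s : State X} {d : ℕ} (hs : s.stack.length ≤ stackLimit)
    (hf : ¬ FaultsFrom E (u ++ p ++ v) ⟨w, s.addGas d⟩) :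
    Advance E (u ++ p ++ v) (u ++ q ++ v) (ConfigRel p q v) ⟨w, s.addGas d⟩ ⟨w, s⟩ := by
  cases w with
  | nil => exact advance_nil _ _ _ _
  | cons i w => exact advance_cons hp hq (.after w) hs hf

theorem ConfigRel.advance (hg : Generated ⟨p, q⟩) {c c' : Config X} (h : ConfigRel p q v c c')
    (hf : ¬ FaultsFrom E (u ++ p ++ v) c) :
    Advance E (u ++ p ++ v) (u ++ q ++ v) (ConfigRel p q v) c c' := by
  obtain ⟨r, _⟩ := c
  obtain ⟨r', s⟩ := c'
  obtain ⟨hr, ⟨d, rfl⟩, hs⟩ := h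
  cases hr with
  | after => exact advance_same hg.lhs_inModel hg.rhs_inModel _ hs hf
  | before w =>
    cases w with
    | cons i w => exact advance_cons hg.lhs_inModel hg.rhs_inModel (.before w) hs hf
    | nil =>
      simp only [List.nil_append] at hf ⊢
      obtain ⟨t₁, h₁⟩ := execSeq_of_not_faultsFrom hg.lhs_inModel hf
      have hr := reaches_of_execSeq (P := u ++ p ++ v) (v := v) h₁
      rw [execSeq_addGas, Option.map_eq_some_iff] at h₁
      obtain ⟨t, ht, rfl⟩ := h₁
      obtain ⟨t₂, h₂, he, -, hlt⟩ := hg.ruleCorrect E s t hs ht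
      obtain ⟨e, rfl⟩ := exists_addGas_of_eqApartGas he hlt.le
      have ha : (t₂.addGas e).addGas d = t₂.addGas (e + d) := by
        simp [State.addGas, Nat.add_assoc]
      rw [ha] at hr
      exact .of_reaches hr (reaches_of_execSeq h₂)
        (advance_same hg.lhs_inModel hg.rhs_inModel v (execSeq_stack_le h₂ hs)
          fun h => hf (.of_reaches hr h))

/-- If one of two corresponding runs is finite and the first does not fault, both halt, with
corresponding outcomes. -/
theorem ConfigRel.halts (hg : Generated ⟨p, q⟩) {c c' : Config X} (h : ConfigRel p q v c c')
    (hf : ¬ FaultsFrom E (u ++ p ++ v) c)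
    (ht : Terminates E (u ++ p ++ v) c ∨ Terminates E (u ++ q ++ v) c') :
    BothHalt E (u ++ p ++ v) (u ++ q ++ v) c c' := by
  rcases ht with ht | ht
  · replace ht := Acc.transGen ht
    induction ht generalizing c' with
    | intro c _ ih =>
      rcases h.advance hg hf with h | ⟨d, d', hS, hd, hd'⟩
      · exact h
      · have hF : ¬ FaultsFrom E (u ++ p ++ v) d :=
          fun hF => hf (.of_reaches hd.to_reflTransGen hF)
        exact .of_reaches hd.to_reflTransGen hd'.to_reflTransGen
          (ih d (Relation.transGen_swap.2 hd) hS hF)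
  · replace ht := Acc.transGen ht
    induction ht generalizing c with
    | intro c' _ ih =>
      rcases h.advance hg hf with h | ⟨d, d', hS, hd, hd'⟩
      · exact h
      · have hF : ¬ FaultsFrom E (u ++ p ++ v) d :=
          fun hF => hf (.of_reaches hd.to_reflTransGen hF)
        exact .of_reaches hd.to_reflTransGen hd'.to_reflTransGen
          (ih d' (Relation.transGen_swap.2 hd') hS hF)

theorem Generated.programCorrect {ρ : Rule} (hρ : Generated ρ) (u v : Code) :
    ProgramCorrect X (u ++ ρ.lhs ++ v) (u ++ ρ.rhs ++ v) := by
  have start : ∀ s : State X, s.stack.length ≤ stackLimit →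
      ConfigRel ρ.lhs ρ.rhs v ⟨u ++ ρ.lhs ++ v, s⟩ ⟨u ++ ρ.rhs ++ v, s⟩ :=
    fun s hs => ⟨.before u, ⟨0, rfl⟩, hs⟩
  refine .of_halts_of_diverges (fun E s o hs ho => ?_) fun E s hs hd => ?_
  · obtain ⟨o₁, o', h₁, h', hr⟩ := (start s hs).halts hρ (HaltsFrom.not_faultsFrom ho)
      (.inl (HaltsFrom.terminates ho))
    obtain rfl := HaltsFrom.unique h₁ ho
    exact ⟨o', h', hr⟩
  · rw [diverges_iff] at hd ⊢
    intro ht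
    obtain ⟨o, _, ho, -⟩ := (start s hs).halts hρ (fun h => hd h.terminates) (.inr ht)
    exact hd ho.terminates

end Simulation

/-! ## Exhaustive application of rules -/

section Rewriting

variable {R : Set Rule}

theorem Rewrites.staticGas_lt (hR : ∀ ρ ∈ R, Generated ρ) {P Q : Code} (h : Rewrites R P Q) :
    staticGas Q < staticGas P := by
  obtain ⟨ρ, hρ, u, v⟩ := h
  have := (hR ρ hρ).cheaper
  simp only [staticGas, List.map_append, List.sum_append] at this ⊢
  omega

theorem wellFounded_rewrites (hR : ∀ ρ ∈ R, Generated ρ) :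
    WellFounded fun Q P : Code => Rewrites R P Q :=
  Subrelation.wf (fun h => h.staticGas_lt hR) (InvImage.wf staticGas Nat.lt_wfRel.wf)

theorem exists_exhaustivelyRewrites (hR : ∀ ρ ∈ R, Generated ρ) (P : Code) :
    ∃ Q, ExhaustivelyRewrites R P Q := by
  induction P using (wellFounded_rewrites hR).induction with
  | h P ih =>
    by_cases h : ∃ Q, Rewrites R P Q
    · obtain ⟨Q, hQ⟩ := h
      obtain ⟨Q', h', hn⟩ := ih Q hQ
      exact ⟨Q', .head hQ h', hn⟩
    · exact ⟨P, .refl, h⟩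

theorem programCorrect_of_rewrites {X : Type*} (hR : ∀ ρ ∈ R, Generated ρ) {P Q : Code}
    (h : Relation.ReflTransGen (Rewrites R) P Q) : ProgramCorrect X P Q := by
  induction h with
  | refl => exact .refl P
  | tail _ h ih =>
    obtain ⟨ρ, hρ, u, v⟩ := h
    exact ih.trans ((hR ρ hρ).programCorrect u v)

end Rewriting

end EVM

theorem mainTheorem6 (X : Type*) :
    -- every rule of the catalogue is one that the optimizer may produce
    (∀ ρ : EVM.Rule, EVM.Catalogue ρ → EVM.Generated ρ) ∧
    -- every generated rule is correct on the full state
    (∀ ρ : EVM.Rule, EVM.Generated ρ → EVM.RuleCorrect X ρ) ∧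
    -- gas consumption grows monotonically during the execution of any program
    (∀ (E : EVM.Env X) (P : EVM.Code) (c c' : EVM.Config X),
      EVM.Reaches E P c c' → c.state.gas ≤ c'.state.gas) ∧
    (∀ (E : EVM.Env X) (P : EVM.Code) (s : EVM.State X) (o : EVM.Outcome X),
      EVM.Halts E P s o → s.gas ≤ o.state.gas) ∧
    -- for every set of generated rules:
    ∀ R : Set EVM.Rule, (∀ ρ ∈ R, EVM.Generated ρ) →
      -- every rule application strictly decreases the gas cost
      (∀ P Q : EVM.Code, EVM.Rewrites R P Q → EVM.staticGas Q < EVM.staticGas P) ∧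
      -- exhaustive application terminates, whatever the order, and reaches a normal form
      WellFounded (fun Q P : EVM.Code => EVM.Rewrites R P Q) ∧
      (∀ P : EVM.Code, ∃ Q, EVM.ExhaustivelyRewrites R P Q) ∧
      -- any number of rule applications, in particular exhaustive application, is correct
      (∀ P Q : EVM.Code, Relation.ReflTransGen (EVM.Rewrites R) P Q →
        EVM.ProgramCorrect X P Q) ∧
      (∀ P Q : EVM.Code, EVM.ExhaustivelyRewrites R P Q → EVM.ProgramCorrect X P Q) := by
  refine ⟨fun _ h => h.generated, fun _ h => h.ruleCorrect, fun _ _ _ _ h => h.gas_le,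
    fun _ _ _ _ h => h.gas_le, fun R hR => ⟨fun _ _ h => h.staticGas_lt hR,
      EVM.wellFounded_rewrites hR, EVM.exists_exhaustivelyRewrites hR,
      fun _ _ h => EVM.programCorrect_of_rewrites hR h,
      fun _ _ h => EVM.programCorrect_of_rewrites hR h.1⟩⟩
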